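/- Identify subsets of $\omega$ with points of Cantor space ${}^\omega 2$ (called \emph{reals}), and let $\lambda$ be the uniform (fair coin) product measure on ${}^\omega 2$. For a finite binary string $\sigma$ let $[\sigma]$ be the set of all $X\in{}^\omega 2$ extending $\sigma$. An oracle $A\subseteq\omega$ is of \emph{hyperimmune degree} if there is a function $f:\omega\to\omega$, $f\le_T A$, such that for no computable function $g$ one has $f(n)\le g(n)$ for almost all $n$; otherwise $A$ is of \emph{hyperimmune-free degree}. An \emph{$A$-computable sequence of Kurtz tests relative to $A$} is a double sequence $(G^i_m)_{i,m\in\omega}$ of clopen subsets of ${}^\omega 2$ such that $\lambda(G^i_m)\le 2^{-m}$ for all $i,m$, and such that from $i$ and $m$ one can compute, with oracle $A$, a finite list of strings $\sigma_0,\dots,\sigma_{k-1}$ with $G^i_m=\bigcup_{j<k}[\sigma_j]$. The oracle $A$ is \emph{weakly Kurtz engulfing} if there is such a sequence for which $\bigcup_i\bigcap_m G^i_m$ contains all computable reals. Both properties depend only on the Turing degree of $A$, and there is a Turing degree that is hyperimmune-free and weakly Kurtz engulfing: that is, there is a Turing degree $\mathbf a$ of a set such that every $A\subseteq\omega$ of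 degree $\mathbf a$ is both of hyperimmune-free degree and weakly Kurtz engulfing. -/

import Mathlib

open MeasureTheory
open scoped ENNReal

/-- Cantor space, whose points ("reals") are identified with subsets of `ℕ`; they also serve as
oracles. -/
abbrev CantorSpace : Type := ℕ → Bool

/-- The characteristic function of `A` as an oracle. -/
def CantorSpace.oracle (A : CantorSpace) : ℕ →. ℕ := fun n => Part.some (A n).toNat

/-- The Turing degree of `A`. -/
def CantorSpace.degree (A : CantorSpace) : TuringDegree :=
  toAntisymmetrization TuringReducible A.oracle

/-- The uniform (fair coin) product measure on Cantor space. -/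
noncomputable def coinMeasure : Measure CantorSpace :=
  Measure.infinitePi fun _ : ℕ => (PMF.uniformOfFintype Bool).toMeasure

/-- The basic clopen set `[σ]` of all sequences extending the string `σ`. -/
def basicClopen (σ : List Bool) : Set CantorSpace :=
  {X | ∀ (n : ℕ) (h : n < σ.length), X n = σ[n]}

/-- The clopen set coded by a finite list of strings. -/
def clopenOf (D : List (List Bool)) : Set CantorSpace :=
  {X | ∃ σ ∈ D, X ∈ basicClopen σ}

/-- `(G i)` is an `A`-computable sequence of Kurtz tests relative to `A`: from `i` and `m`, the
oracle `A` computes a finite list of strings coding the clopen set `G i m`, and the measure of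
`G i m` is at most `2⁻ᵐ`. -/
structure IsKurtzTestSequence (A : CantorSpace) (G : ℕ → ℕ → Set CantorSpace) : Prop where
  effective : ∃ D : ℕ → ℕ → List (List Bool),
    ComputableIn₂ {A.oracle} D ∧ ∀ i m, G i m = clopenOf (D i m)
  measure_le : ∀ i m, coinMeasure (G i m) ≤ (2⁻¹ : ℝ≥0∞) ^ m

/-- Some `A`-computable sequence of Kurtz tests relative to `A` is such that the union of the
associated Kurtz null sets contains all computable reals. -/
def IsWeaklyKurtzEngulfing (A : CantorSpace) : Prop :=
  ∃ G : ℕ → ℕ → Set CantorSpace, IsKurtzTestSequence A G ∧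
    ∀ X : CantorSpace, Computable X → X ∈ ⋃ i, ⋂ m, G i m

/-- `A` is of hyperimmune degree: `A` computes a function that is not dominated by any computable
function. -/
def IsHyperimmuneOracle (A : CantorSpace) : Prop :=
  ∃ f : ℕ → ℕ, ComputableIn {A.oracle} f ∧
    ∀ g : ℕ → ℕ, Computable g → ¬ ∀ᶠ n in Filter.atTop, f n ≤ g n

/-- `A` is of hyperimmune-free degree. -/
def IsHyperimmuneFreeOracle (A : CantorSpace) : Prop := ¬ IsHyperimmuneOracle A

/-! Consider the sets `A` whose row `e`, `n ↦ A ⟨e, n⟩`, agrees with the `e`-th partial computable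
function wherever the latter has value 0 or 1. They form a nonempty `Π⁰₁` class, and every
computable real is a row of each member. Hence the cylinders given by the first `m` bits of row `i`
are Kurtz tests of measure `2⁻ᵐ` whose null sets are the singletons of the rows, so each member is
weakly Kurtz engulfing.

The hyperimmune-free basis theorem supplies a hyperimmune-free member. Its proof forces with
nonempty `Π⁰₁` classes: for each oracle functional, either some input diverges on a nonempty
subclass, or compactness bounds all values computably (`exists_computable_bound`). Both properties
then pass between Turing equivalent oracles. -/

open Encodable
open Nat.Partrec (Code)

/-! ### Initial segments of reals -/

/-- The string consisting of the first `k` bits of `X`. -/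
def initialSegment (X : CantorSpace) (k : ℕ) : List Bool := (List.range k).map X

@[simp] theorem length_initialSegment (X : CantorSpace) (k : ℕ) :
    (initialSegment X k).length = k := by simp [initialSegment]

theorem initialSegment_succ (X : CantorSpace) (k : ℕ) :
    initialSegment X (k + 1) = initialSegment X k ++ [X k] := by
  simp [initialSegment, List.range_succ]

theorem initialSegment_getD (X : CantorSpace) {j k : ℕ} (h : j < k) :
    (initialSegment X k).getD j false = X j := by
  simp [initialSegment, h]

theorem take_initialSegment (X : CantorSpace) {j k : ℕ} (h : j ≤ k) :
    (initialSegment X k).take j = initialSegment X j := by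
  simp [initialSegment, ← List.map_take, List.take_range, h]

theorem initialSegment_prefix (X : CantorSpace) {j k : ℕ} (h : j ≤ k) :
    initialSegment X j <+: initialSegment X k :=
  take_initialSegment X h ▸ List.take_prefix _ _

theorem initialSegment_of_length {σ : List Bool} {k : ℕ} (h : σ.length = k) :
    initialSegment (fun i => σ.getD i false) k = σ := by
  subst h
  refine List.ext_getElem (by simp) fun i h₁ h₂ => ?_
  simp [initialSegment, h₂]

/-! ### Oracle computations as monotone functionals on strings -/

/-- A primitive recursive approximation to an oracle computation: `t σ n` is the output on input
`n`, if any, found by a computation bounded by the length of `σ` using only the oracle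
information in `σ`. -/
structure IsUseFunctional (t : List Bool → ℕ → Option ℕ) : Prop where
  primrec : Primrec₂ t
  mono : ∀ {σ τ : List Bool}, σ <+: τ → ∀ {n v : ℕ}, t σ n = some v → t τ n = some v

namespace IsUseFunctional

variable {t : List Bool → ℕ → Option ℕ} {A : CantorSpace}

theorem mono_initialSegment (ht : IsUseFunctional t) {j k n v : ℕ} (h : j ≤ k)
    (hv : t (initialSegment A j) n = some v) : t (initialSegment A k) n = some v :=
  ht.mono (initialSegment_prefix A h) hv

theorem unique (ht : IsUseFunctional t) {j k n v w : ℕ}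
    (hv : t (initialSegment A j) n = some v) (hw : t (initialSegment A k) n = some w) :
    v = w := by
  have h₁ := ht.mono_initialSegment (le_max_left j k) hv
  have h₂ := ht.mono_initialSegment (le_max_right j k) hw
  exact Option.some.inj (h₁.symm.trans h₂)

end IsUseFunctional

/-- The functional `t` with oracle `A` computes the partial function `f`. -/
def Represents (t : List Bool → ℕ → Option ℕ) (A : CantorSpace) (f : ℕ →. ℕ) : Prop :=
  ∀ n v, v ∈ f n ↔ ∃ k, t (initialSegment A k) n = some v

theorem exists_isUseFunctional_of_primrec {A : CantorSpace} {f : ℕ → ℕ} (hf : Primrec f) :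
    ∃ t, IsUseFunctional t ∧ Represents t A (fun n => Part.some (f n)) := by
  refine ⟨fun _ n => some (f n), ⟨Primrec.option_some.comp (hf.comp Primrec.snd), by simp⟩, ?_⟩
  intro n v
  simp [eq_comm]

theorem exists_isUseFunctional_oracle (A : CantorSpace) :
    ∃ t, IsUseFunctional t ∧ Represents t A A.oracle := by
  refine ⟨fun σ n => (σ[n]?).map Bool.toNat, ⟨?_, ?_⟩, ?_⟩
  · exact Primrec.option_map Primrec.list_getElem?
      ((Primrec.dom_bool Bool.toNat).comp Primrec.snd).to₂
  · rintro σ _ ⟨ρ, rfl⟩ n v h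
    simp only [Option.map_eq_some_iff] at h ⊢
    obtain ⟨b, hb, rfl⟩ := h
    obtain ⟨hn, -⟩ := List.getElem?_eq_some_iff.1 hb
    exact ⟨b, by rw [List.getElem?_append_left hn, hb], rfl⟩
  · intro n v
    simp only [CantorSpace.oracle, Part.mem_some_iff, Option.map_eq_some_iff]
    constructor
    · rintro rfl
      exact ⟨n + 1, A n, by simp [initialSegment], rfl⟩
    · rintro ⟨k, b, hb, rfl⟩
      obtain ⟨hn, rfl⟩ := List.getElem?_eq_some_iff.1 hb
      simp [initialSegment]

theorem exists_isUseFunctional_pair {A : CantorSpace} {f h : ℕ →. ℕ} {t u}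
    (ht : IsUseFunctional t) (htf : Represents t A f)
    (hu : IsUseFunctional u) (huh : Represents u A h) :
    ∃ w, IsUseFunctional w ∧ Represents w A fun n => (Nat.pair <$> f n <*> h n) := by
  refine ⟨fun σ n => (t σ n).bind fun a => (u σ n).map fun b => Nat.pair a b, ⟨?_, ?_⟩, ?_⟩
  · refine Primrec.option_bind ht.primrec (Primrec.option_map
      (hu.primrec.comp (Primrec.fst.comp Primrec.fst) (Primrec.snd.comp Primrec.fst)) ?_)
    exact (Primrec₂.natPair.comp (Primrec.snd.comp Primrec.fst) Primrec.snd).to₂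
  · intro σ τ hστ n v hv
    simp only [Option.bind_eq_some_iff, Option.map_eq_some_iff] at hv ⊢
    obtain ⟨a, ha, b, hb, rfl⟩ := hv
    exact ⟨a, ht.mono hστ ha, b, hu.mono hστ hb, rfl⟩
  · intro n v
    simp only [Option.bind_eq_some_iff, Option.map_eq_some_iff, Seq.seq, Part.map_eq_map,
      Part.mem_bind_iff, Part.mem_map_iff]
    constructor
    · rintro ⟨_, ⟨a, ha, rfl⟩, b, hb, rfl⟩
      obtain ⟨j, hj⟩ := (htf n a).1 ha
      obtain ⟨k, hk⟩ := (huh n b).1 hb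
      exact ⟨max j k, a, ht.mono_initialSegment (le_max_left _ _) hj, b,
        hu.mono_initialSegment (le_max_right _ _) hk, rfl⟩
    · rintro ⟨k, a, ha, b, hb, rfl⟩
      exact ⟨_, ⟨a, (htf n a).2 ⟨k, ha⟩, rfl⟩, b, (huh n b).2 ⟨k, hb⟩, rfl⟩

theorem exists_isUseFunctional_comp {A : CantorSpace} {f h : ℕ →. ℕ} {t u}
    (ht : IsUseFunctional t) (htf : Represents t A f)
    (hu : IsUseFunctional u) (huh : Represents u A h) :
    ∃ w, IsUseFunctional w ∧ Represents w A fun n => (h n).bind f := by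
  refine ⟨fun σ n => (u σ n).bind (t σ), ⟨?_, ?_⟩, ?_⟩
  · exact Primrec.option_bind hu.primrec
      (ht.primrec.comp (Primrec.fst.comp Primrec.fst) Primrec.snd).to₂
  · intro σ τ hστ n v hv
    simp only [Option.bind_eq_some_iff] at hv ⊢
    obtain ⟨a, ha, hb⟩ := hv
    exact ⟨a, hu.mono hστ ha, ht.mono hστ hb⟩
  · intro n v
    refine Part.mem_bind_iff.trans ?_
    simp only [Option.bind_eq_some_iff]
    constructor
    · rintro ⟨a, ha, hb⟩
      obtain ⟨j, hj⟩ := (huh n a).1 ha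
      obtain ⟨k, hk⟩ := (htf a v).1 hb
      exact ⟨max j k, a, hu.mono_initialSegment (le_max_left _ _) hj,
        ht.mono_initialSegment (le_max_right _ _) hk⟩
    · rintro ⟨k, a, ha, hb⟩
      exact ⟨a, (huh n a).2 ⟨k, ha⟩, (htf a v).2 ⟨k, hb⟩⟩

theorem exists_isUseFunctional_prec {A : CantorSpace} {f h : ℕ →. ℕ} {t u}
    (ht : IsUseFunctional t) (htf : Represents t A f)
    (hu : IsUseFunctional u) (huh : Represents u A h) :
    ∃ w, IsUseFunctional w ∧ Represents w A fun p =>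
      p.unpair.2.rec (f p.unpair.1) fun y IH =>
        IH.bind fun i => h (Nat.pair p.unpair.1 (Nat.pair y i)) := by
  let r (σ : List Bool) (a n : ℕ) : Option ℕ :=
    n.rec (t σ a) fun y IH => IH.bind fun i => u σ (Nat.pair a (Nat.pair y i))
  have hmono : ∀ {σ τ : List Bool}, σ <+: τ → ∀ {a n v : ℕ}, r σ a n = some v →
      r τ a n = some v := by
    intro σ τ hστ a n
    induction n with
    | zero => exact fun hv => ht.mono hστ hv
    | succ n ih =>
      intro v hv
      obtain ⟨i, hi, hv⟩ := Option.bind_eq_some_iff.1 hv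
      exact Option.bind_eq_some_iff.2 ⟨i, ih hi, hu.mono hστ hv⟩
  refine ⟨fun σ p => r σ p.unpair.1 p.unpair.2, ⟨?_, fun {σ τ} hστ {n v} => hmono hστ⟩, ?_⟩
  · have hun : Primrec fun p : List Bool × ℕ => p.2.unpair := Primrec.unpair.comp Primrec.snd
    have hstep : Primrec₂ fun (p : List Bool × ℕ) (q : ℕ × Option ℕ) =>
        q.2.bind fun i => u p.1 (Nat.pair p.2.unpair.1 (Nat.pair q.1 i)) := by
      refine Primrec.option_bind (Primrec.snd.comp Primrec.snd) (hu.primrec.comp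
        (Primrec.fst.comp (Primrec.fst.comp Primrec.fst)) ?_)
      exact Primrec₂.natPair.comp (Primrec.fst.comp (hun.comp (Primrec.fst.comp Primrec.fst)))
        (Primrec₂.natPair.comp (Primrec.fst.comp (Primrec.snd.comp Primrec.fst)) Primrec.snd)
    refine Primrec.of_eq (Primrec.nat_rec' (Primrec.snd.comp hun)
      (ht.primrec.comp Primrec.fst (Primrec.fst.comp hun))
      hstep) fun p => rfl
  · intro p
    beta_reduce
    generalize p.unpair.1 = a
    induction p.unpair.2 with
    | zero => exact htf a
    | succ n ih =>
      intro v
      refine Part.mem_bind_iff.trans ?_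
      simp only [ih, huh _ v]
      constructor
      · rintro ⟨i, ⟨j, hj⟩, k, hk⟩
        exact ⟨max j k, Option.bind_eq_some_iff.2 ⟨i,
          hmono (initialSegment_prefix A (le_max_left _ _)) hj,
          hu.mono_initialSegment (le_max_right _ _) hk⟩⟩
      · rintro ⟨k, hk⟩
        obtain ⟨i, hi, hv⟩ := Option.bind_eq_some_iff.1 hk
        exact ⟨i, ⟨k, hi⟩, k, hv⟩

theorem exists_isUseFunctional_rfind {A : CantorSpace} {f : ℕ →. ℕ} {t}
    (ht : IsUseFunctional t) (htf : Represents t A f) :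
    ∃ w, IsUseFunctional w ∧ Represents w A fun a =>
      Nat.rfind fun n => (fun m => m = 0) <$> f (Nat.pair a n) := by
  -- The default 0 makes an undefined value below `x` fail, so `P` demands that all earlier values
  -- have converged and are nonzero.
  let P (σ : List Bool) (a x : ℕ) : Prop :=
    t σ (Nat.pair a x) = some 0 ∧ ∀ m < x, (t σ (Nat.pair a m)).getD 0 ≠ 0
  have hP_unique : ∀ {σ a x y}, P σ a x → P σ a y → x = y := by
    intro σ a x y hx hy
    rcases lt_trichotomy x y with h | h | h
    · exact absurd (by simp [hx.1]) (hy.2 x h)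
    · exact h
    · exact absurd (by simp [hy.1]) (hx.2 y h)
  have hP_mono : ∀ {σ τ : List Bool}, σ <+: τ → ∀ {a x}, P σ a x → P τ a x := by
    intro σ τ hστ a x hx
    refine ⟨ht.mono hστ hx.1, fun m hm => ?_⟩
    have := hx.2 m hm
    cases hv : t σ (Nat.pair a m) with
    | none => simp [hv] at this
    | some v => rw [ht.mono hστ hv]; simpa [hv] using this
  have hP_primrec : PrimrecRel fun (p : List Bool × ℕ) x => P p.1 p.2 x := by
    have hq : Primrec₂ fun (m : ℕ) (p : List Bool × ℕ) => t p.1 (Nat.pair p.2 m) :=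
      ht.primrec.comp (Primrec.fst.comp Primrec.snd)
        (Primrec₂.natPair.comp (Primrec.snd.comp Primrec.snd) Primrec.fst)
    refine PrimrecPred.and ?_ ?_
    · exact Primrec.eq.comp (hq.comp Primrec.snd Primrec.fst) (Primrec.const _)
    · have : PrimrecRel fun (m : ℕ) (p : List Bool × ℕ) =>
          ¬ (t p.1 (Nat.pair p.2 m)).getD 0 = 0 :=
        (Primrec.eq.comp (Primrec.option_getD.comp hq (Primrec.const 0)) (Primrec.const 0)).not
      exact (this.forall_mem_list.comp (Primrec.list_range.comp Primrec.snd) Primrec.fst).of_eq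
        (by simp)
  classical
  -- The solution of `P` is unique, so a bounded search for the greatest one finds it; the test
  -- discards the fallback 0 of a failed search.
  let w (σ : List Bool) (a : ℕ) : Option ℕ :=
    if P σ a (Nat.findGreatest (P σ a) σ.length) then
      some (Nat.findGreatest (P σ a) σ.length) else none
  have hw : ∀ {σ a x}, w σ a = some x ↔ x ≤ σ.length ∧ P σ a x := by
    intro σ a x
    simp only [w]
    constructor
    · intro h
      split_ifs at h with h'
      obtain rfl := Option.some.inj h
      exact ⟨Nat.findGreatest_le _, h'⟩
    · rintro ⟨hx, hPx⟩
      have := Nat.findGreatest_spec hx hPx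
      rw [if_pos this, hP_unique this hPx]
  refine ⟨w, ⟨?_, ?_⟩, ?_⟩
  · have hg : Primrec fun p : List Bool × ℕ => Nat.findGreatest (P p.1 p.2) p.1.length :=
      Primrec.nat_findGreatest (Primrec.list_length.comp Primrec.fst) hP_primrec
    exact Primrec.ite (hP_primrec.comp Primrec.id hg) (Primrec.option_some.comp hg)
      (Primrec.const none)
  · intro σ τ hστ n v hv
    rw [hw] at hv ⊢
    exact ⟨hv.1.trans hστ.length_le, hP_mono hστ hv.2⟩
  · intro a x
    refine Nat.mem_rfind.trans ?_
    simp only [hw, Part.map_eq_map, Part.mem_map_iff, length_initialSegment]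
    constructor
    · rintro ⟨⟨z, hz, hz0⟩, hlt⟩
      obtain rfl : z = 0 := by simpa using hz0
      obtain ⟨k, hk⟩ := (htf _ _).1 hz
      have : ∀ m, ∃ j, m < x → (t (initialSegment A j) (Nat.pair a m)).getD 0 ≠ 0 := by
        intro m
        by_cases hm : m < x
        · obtain ⟨v, hv, hv0⟩ := hlt hm
          obtain ⟨j, hj⟩ := (htf _ _).1 hv
          exact ⟨j, fun _ => by simpa [hj] using hv0⟩
        · exact ⟨0, fun h => absurd h hm⟩
      choose j hj using this
      let K := max (max k x) ((Finset.range x).sup j)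
      refine ⟨K, by simp [K], ht.mono_initialSegment (by simp [K]) hk, fun m hm => ?_⟩
      have hm' := hj m hm
      have hjK : j m ≤ K := (Finset.le_sup (f := j) (Finset.mem_range.2 hm)).trans (by simp [K])
      cases hv : t (initialSegment A (j m)) (Nat.pair a m) with
      | none => simp [hv] at hm'
      | some v => rw [ht.mono_initialSegment hjK hv]; simpa [hv] using hm'
    · rintro ⟨k, -, h0, hlt⟩
      refine ⟨⟨0, (htf _ _).2 ⟨k, h0⟩, by simp⟩, fun {m} hm => ?_⟩
      have := hlt m hm
      cases hv : t (initialSegment A k) (Nat.pair a m) with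
      | none => simp [hv] at this
      | some v => exact ⟨v, (htf _ _).2 ⟨k, hv⟩, by simpa [hv] using this⟩

/-- A halting computation reads finitely many oracle bits. The functionals obtained form a countable
family not depending on `A`, so they can be listed before `A` is constructed. -/
theorem exists_isUseFunctional {A : CantorSpace} {f : ℕ →. ℕ}
    (hf : Nat.RecursiveIn {A.oracle} f) : ∃ t, IsUseFunctional t ∧ Represents t A f := by
  induction hf with
  | zero => exact exists_isUseFunctional_of_primrec (Primrec.const 0)
  | succ => exact exists_isUseFunctional_of_primrec Primrec.succ
  | left => exact exists_isUseFunctional_of_primrec (Primrec.fst.comp Primrec.unpair)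
  | right => exact exists_isUseFunctional_of_primrec (Primrec.snd.comp Primrec.unpair)
  | oracle g hg => exact Set.mem_singleton_iff.1 hg ▸ exists_isUseFunctional_oracle A
  | pair _ _ ihf ihh =>
    obtain ⟨t, ht, htf⟩ := ihf
    obtain ⟨u, hu, huh⟩ := ihh
    exact exists_isUseFunctional_pair ht htf hu huh
  | comp _ _ ihf ihh =>
    obtain ⟨t, ht, htf⟩ := ihf
    obtain ⟨u, hu, huh⟩ := ihh
    exact exists_isUseFunctional_comp ht htf hu huh
  | prec _ _ ihf ihh =>
    obtain ⟨t, ht, htf⟩ := ihf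
    obtain ⟨u, hu, huh⟩ := ihh
    exact exists_isUseFunctional_prec ht htf hu huh
  | rfind _ ihf =>
    obtain ⟨t, ht, htf⟩ := ihf
    exact exists_isUseFunctional_rfind ht htf

/-! ### `Π⁰₁` classes and compactness -/

/-- The closed set of all `X` without an initial segment satisfying `R`; for decidable `R` this
is a `Π⁰₁` class. -/
def avoidanceClass (R : List Bool → Prop) : Set CantorSpace :=
  {X | ∀ k, ¬ R (initialSegment X k)}

theorem isClopen_setOf_initialSegment (R : List Bool → Prop) (k : ℕ) :
    IsClopen {X | R (initialSegment X k)} := by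
  have : {X | R (initialSegment X k)} =
      (fun (X : CantorSpace) (i : Fin k) => X i) ⁻¹' {Y | R (List.ofFn Y)} := by
    ext X
    have : initialSegment X k = List.ofFn fun i : Fin k => X i :=
      List.ext_getElem (by simp) (by simp [initialSegment])
    simp [this]
  rw [this]
  exact (isClopen_discrete _).preimage (by fun_prop)

theorem isClosed_avoidanceClass (R : List Bool → Prop) : IsClosed (avoidanceClass R) := by
  simp only [avoidanceClass, Set.ofPred_forall]
  exact isClosed_iInter fun k => (isClopen_setOf_initialSegment (fun σ => ¬ R σ) k).isClosed

/-- König's lemma for the full binary tree. -/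
theorem exists_bound_of_avoidanceClass_eq_empty {R : List Bool → Prop}
    (h : avoidanceClass R = ∅) : ∃ L, ∀ X, ∃ k < L, R (initialSegment X k) := by
  obtain ⟨s, hs⟩ := isCompact_univ.elim_finite_subcover
    (fun k => {X : CantorSpace | R (initialSegment X k)})
    (fun k => (isClopen_setOf_initialSegment R k).isOpen) (by
      intro X _
      by_contra hX
      exact (Set.mem_empty_iff_false X).1 (h ▸ fun k hk => hX (Set.mem_iUnion.2 ⟨k, hk⟩)))
  refine ⟨s.sup id + 1, fun X => ?_⟩
  obtain ⟨k, hk, hX⟩ := Set.mem_iUnion₂.1 (hs (Set.mem_univ X))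
  exact ⟨k, Nat.lt_succ_of_le (Finset.le_sup (f := id) hk), hX⟩

/-- The list of all binary strings of a given length. -/
def stringsOfLength (L : ℕ) : List (List Bool) :=
  L.rec [[]] fun _ S => S.flatMap fun σ => [σ ++ [false], σ ++ [true]]

theorem primrec_stringsOfLength : Primrec stringsOfLength := by
  refine Primrec.nat_rec₁ _ (Primrec.list_flatMap Primrec.snd ?_)
  have hc (b : Bool) : Primrec fun p : (ℕ × List (List Bool)) × List Bool => p.2 ++ [b] :=
    Primrec.list_append.comp Primrec.snd (Primrec.const [b])
  exact Primrec.list_cons.comp (hc false) (Primrec.list_cons.comp (hc true) (Primrec.const []))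

theorem length_of_mem_stringsOfLength {L : ℕ} {σ : List Bool} (h : σ ∈ stringsOfLength L) :
    σ.length = L := by
  induction L generalizing σ with
  | zero => simpa [stringsOfLength] using h
  | succ L ih =>
    obtain ⟨τ, hτ, h⟩ := List.mem_flatMap.1 h
    have := ih hτ
    rcases (by simpa using h : σ = τ ++ [false] ∨ σ = τ ++ [true]) with rfl | rfl <;> simp [this]

theorem initialSegment_mem_stringsOfLength (X : CantorSpace) (L : ℕ) :
    initialSegment X L ∈ stringsOfLength L := by
  induction L with
  | zero => simp [stringsOfLength, initialSegment]
  | succ L ih =>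
    refine List.mem_flatMap.2 ⟨_, ih, ?_⟩
    rw [initialSegment_succ]
    cases X L <;> simp

theorem le_foldl_max {α : Type*} (f : α → ℕ) (l : List α) (b : ℕ) :
    b ≤ l.foldl (fun m a => max m (f a)) b ∧
      ∀ a ∈ l, f a ≤ l.foldl (fun m a => max m (f a)) b := by
  induction l generalizing b with
  | nil => simp
  | cons a l ih =>
    obtain ⟨h₁, h₂⟩ := ih (max b (f a))
    refine ⟨(le_max_left _ _).trans h₁, fun c hc => ?_⟩
    rcases List.mem_cons.1 hc with rfl | hc
    · exact (le_max_right _ _).trans h₁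
    · exact h₂ c hc

/-- If the functional `t` is total on a `Π⁰₁` class, then its values there are bounded by a
computable function. -/
theorem exists_computable_bound {R : List Bool → Prop} (hR : PrimrecPred R)
    {t : List Bool → ℕ → Option ℕ} (ht : IsUseFunctional t)
    (h : ∀ n, avoidanceClass (fun σ => R σ ∨ t σ n ≠ none) = ∅) :
    ∃ g : ℕ → ℕ, Computable g ∧
      ∀ X ∈ avoidanceClass R, ∀ n k v, t (initialSegment X k) n = some v → v ≤ g n := by
  -- At level `L` every string has already left the class or made `t` converge at `n`. This is
  -- decidable, and compactness gives such an `L`, so the least one is found by unbounded search.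
  let Q (n L : ℕ) : Prop :=
    ∀ σ ∈ stringsOfLength L, ∃ k < L, R (σ.take k) ∨ t (σ.take k) n ≠ none
  have hQ : PrimrecRel Q := by
    have h₁ : PrimrecRel fun (k : ℕ) (p : List Bool × ℕ) =>
        R (p.1.take k) ∨ t (p.1.take k) p.2 ≠ none := by
      have htake : Primrec fun q : ℕ × (List Bool × ℕ) => q.2.1.take q.1 :=
        Primrec.list_take.comp Primrec.fst (Primrec.fst.comp Primrec.snd)
      exact (hR.comp htake).or (Primrec.eq.comp
        (ht.primrec.comp htake (Primrec.snd.comp Primrec.snd)) (Primrec.const none)).not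
    have h₂ : PrimrecRel fun (σ : List Bool) (p : ℕ × ℕ) =>
        ∃ k ∈ List.range p.2, R (σ.take k) ∨ t (σ.take k) p.1 ≠ none :=
      h₁.exists_mem_list.comp (Primrec.list_range.comp (Primrec.snd.comp Primrec.snd))
        (Primrec.pair Primrec.fst (Primrec.fst.comp Primrec.snd))
    exact (h₂.forall_mem_list.comp (primrec_stringsOfLength.comp Primrec.snd) Primrec.id).of_eq
      (by simp [Q])
  have hex : ∀ n, ∃ L, Q n L := by
    intro n
    obtain ⟨L, hL⟩ := exists_bound_of_avoidanceClass_eq_empty (h n)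
    refine ⟨L, fun σ hσ => ?_⟩
    obtain ⟨k, hk, hRk⟩ := hL fun i => σ.getD i false
    refine ⟨k, hk, ?_⟩
    rwa [← take_initialSegment _ hk.le,
      initialSegment_of_length (length_of_mem_stringsOfLength hσ)] at hRk
  classical
  have hL : Computable fun n => Nat.find (hex n) := by
    refine Partrec.of_eq_tot (f := fun n => Nat.rfind fun L => Part.some (decide (Q n L)))
      (Partrec.rfind hQ.decide.to_comp.partrec) fun n => ?_
    exact Nat.mem_rfind.2 ⟨by simpa using Nat.find_spec (hex n),
      fun hm => by simpa using Nat.find_min (hex n) hm⟩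
  -- The bound is the maximum over all strings of length `L`; those without a value contribute 0.
  have hfold : Primrec₂ fun (n L : ℕ) =>
      (stringsOfLength L).foldl (fun m σ => max m ((t σ n).getD 0)) 0 := by
    have hstep : Primrec₂ fun (p : ℕ × ℕ) (q : ℕ × List Bool) =>
        max q.1 ((t q.2 p.1).getD 0) :=
      Primrec.nat_max.comp (Primrec.fst.comp Primrec.snd) (Primrec.option_getD.comp
        (ht.primrec.comp (Primrec.snd.comp Primrec.snd) (Primrec.fst.comp Primrec.fst))
        (Primrec.const 0))
    exact Primrec.list_foldl (primrec_stringsOfLength.comp Primrec.snd) (Primrec.const 0) hstep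
  refine ⟨_, hfold.to_comp.comp Computable.id hL, fun X hX n k v hv => ?_⟩
  have hmem := initialSegment_mem_stringsOfLength X (Nat.find (hex n))
  obtain ⟨j, hj, hRj⟩ := Nat.find_spec (hex n) _ hmem
  rw [take_initialSegment _ hj.le] at hRj
  obtain ⟨w, hw⟩ := Option.ne_none_iff_exists'.1 (hRj.resolve_left (hX j))
  obtain rfl := ht.unique hv hw
  have := (le_foldl_max (fun σ => (t σ n).getD 0) _ 0).2 _ hmem
  rwa [ht.mono_initialSegment hj.le hw, Option.getD_some] at this

/-! ### The hyperimmune-free basis theorem -/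

/-- On the class `P`, the functional `t` is either never total, or always bounded by one
computable function. -/
def Decides (P : Set CantorSpace) (t : List Bool → ℕ → Option ℕ) : Prop :=
  (∃ n, ∀ X ∈ P, ∀ k, t (initialSegment X k) n = none) ∨
    ∃ g : ℕ → ℕ, Computable g ∧
      ∀ X ∈ P, ∀ n k v, t (initialSegment X k) n = some v → v ≤ g n

/-- Divergence of `t` at a fixed `n` is itself a `Π⁰₁` condition. If it meets the class for some
`n`, pass to the intersection; otherwise `t` is total on the class, which needs no shrinking. -/
theorem exists_avoidanceClass_decides {R : List Bool → Prop} (hR : PrimrecPred R)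
    (hne : (avoidanceClass R).Nonempty) {t : List Bool → ℕ → Option ℕ}
    (ht : IsUseFunctional t) :
    ∃ S, PrimrecPred S ∧ (avoidanceClass S).Nonempty ∧
      avoidanceClass S ⊆ avoidanceClass R ∧ Decides (avoidanceClass S) t := by
  by_cases h : ∀ n, avoidanceClass (fun σ => R σ ∨ t σ n ≠ none) = ∅
  · exact ⟨R, hR, hne, subset_rfl, Or.inr (exists_computable_bound hR ht h)⟩
  · obtain ⟨n, hn⟩ := not_forall.1 h
    refine ⟨fun σ => R σ ∨ t σ n ≠ none, ?_, Set.nonempty_iff_ne_empty.2 hn,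
      fun X hX k hk => hX k (Or.inl hk), Or.inl ⟨n, fun X hX k => ?_⟩⟩
    · exact hR.or (Primrec.eq.comp (ht.primrec.comp Primrec.id (Primrec.const n))
        (Primrec.const none)).not
    · by_contra hk
      exact hX k (Or.inr hk)

/-- A function is determined by any program for its encoded version, and there are countably many
programs. -/
theorem countable_setOf_primrec {α β : Type*} [Primcodable α] [Primcodable β] :
    {f : α → β | Primrec f}.Countable := by
  have h : ∀ f : {f : α → β | Primrec f}, ∃ c : Code,
      c.eval = fun n => Part.some (encode ((decode (α := α) n).map f.1)) := fun f =>
    Code.exists_code.1 (Nat.Partrec.of_primrec f.2)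
  choose c hc using h
  refine Set.countable_coe_iff.1 (Function.Injective.countable (f := c) fun f g hfg => ?_)
  have heq := (hc f).symm.trans (hfg ▸ hc g)
  refine Subtype.ext (funext fun a => ?_)
  simpa using congrFun heq (encode a)

theorem countable_setOf_isUseFunctional : {t | IsUseFunctional t}.Countable := by
  refine ((countable_setOf_primrec (α := List Bool × ℕ) (β := Option ℕ)).preimage
    (f := Function.uncurry) Function.uncurry_injective).mono fun t ht => ht.primrec

theorem isUseFunctional_const_none : IsUseFunctional fun _ _ => none :=
  ⟨Primrec.const none, by simp⟩

/-- The hyperimmune-free basis theorem. -/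
theorem exists_isHyperimmuneFreeOracle_mem_avoidanceClass {R : List Bool → Prop}
    (hR : PrimrecPred R) (hne : (avoidanceClass R).Nonempty) :
    ∃ A ∈ avoidanceClass R, IsHyperimmuneFreeOracle A := by
  obtain ⟨t, ht⟩ := countable_setOf_isUseFunctional.exists_eq_range
    ⟨_, isUseFunctional_const_none⟩
  have htuse (i : ℕ) : IsUseFunctional (t i) := by
    have : t i ∈ Set.range t := ⟨i, rfl⟩
    rwa [← ht] at this
  let Condition := {S : List Bool → Prop // PrimrecPred S ∧ (avoidanceClass S).Nonempty}
  have hnext (i : ℕ) (S : Condition) : ∃ S' : Condition,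
      avoidanceClass S'.1 ⊆ avoidanceClass S.1 ∧ Decides (avoidanceClass S'.1) (t i) := by
    obtain ⟨S', h₁, h₂, h₃⟩ := exists_avoidanceClass_decides S.2.1 S.2.2 (htuse i)
    exact ⟨⟨S', h₁, h₂⟩, h₃⟩
  choose next hsub hdec using hnext
  -- Class `i + 1` decides functional `i`; a point of the intersection, which exists by compactness,
  -- meets every requirement.
  let P (i : ℕ) : Condition := i.rec ⟨R, hR, hne⟩ next
  obtain ⟨A, hA⟩ := IsCompact.nonempty_iInter_of_sequence_nonempty_isCompact_isClosed
    (fun i => avoidanceClass (P i).1) (fun i => hsub i (P i)) (fun i => (P i).2.2)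
    (isClosed_avoidanceClass _).isCompact (fun i => isClosed_avoidanceClass _)
  rw [Set.mem_iInter] at hA
  refine ⟨A, hA 0, ?_⟩
  rintro ⟨f, hf, hdom⟩
  obtain ⟨u, hu, huf⟩ := exists_isUseFunctional (RecursiveIn.iff_nat.1 hf)
  obtain ⟨i, rfl⟩ : u ∈ Set.range t := ht ▸ hu
  have hval (n : ℕ) := (huf n (f n)).1 (Part.mem_some _)
  rcases hdec i (P i) with ⟨n, hn⟩ | ⟨g, hg, hle⟩
  · obtain ⟨k, hk⟩ := hval n
    simp [hn A (hA (i + 1)) k] at hk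
  · refine hdom g hg (Filter.Eventually.of_forall fun n => ?_)
    obtain ⟨k, hk⟩ := hval n
    exact hle A (hA (i + 1)) n k _ hk

/-! ### The class of sets whose rows cover the computable reals -/

/-- `σ` is incompatible with being an initial segment of a set whose `e`-th row extends the
`e`-th partial computable function, as witnessed by a computation coded by the length of `σ`. -/
def RefutesRows (σ : List Bool) : Prop :=
  σ.length.unpair.2 < σ.length ∧
    (Denumerable.ofNat Code σ.length.unpair.2.unpair.1).evaln σ.length.unpair.1
      σ.length.unpair.2.unpair.2 = some (!σ.getD σ.length.unpair.2 false).toNat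

theorem primrecPred_refutesRows : PrimrecPred RefutesRows := by
  have hun : Primrec fun σ : List Bool => σ.length.unpair :=
    Primrec.unpair.comp Primrec.list_length
  have hj : Primrec fun σ : List Bool => σ.length.unpair.2 := Primrec.snd.comp hun
  have hj' : Primrec fun σ : List Bool => σ.length.unpair.2.unpair := Primrec.unpair.comp hj
  refine (Primrec.nat_lt.comp hj Primrec.list_length).and (Primrec.eq.comp ?_ ?_)
  · exact Code.primrec_evaln.comp (Primrec.pair (Primrec.pair (Primrec.fst.comp hun)
      ((Primrec.ofNat Code).comp (Primrec.fst.comp hj'))) (Primrec.snd.comp hj'))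
  · exact Primrec.option_some.comp ((Primrec.dom_bool fun b => (!b).toNat).comp
      ((Primrec.list_getD false).comp Primrec.id hj))

/-- Put `⟨e, x⟩` into the set exactly when program `e` outputs 1 on `x`. Output 0 then agrees as
well, and divergence or other outputs never refute anything. -/
theorem avoidanceClass_refutesRows_nonempty : (avoidanceClass RefutesRows).Nonempty := by
  classical
  refine ⟨fun j => decide (1 ∈ (Denumerable.ofNat Code j.unpair.1).eval j.unpair.2), ?_⟩
  rintro k ⟨hj, hk⟩
  rw [length_initialSegment] at hj hk
  rw [initialSegment_getD _ hj] at hk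
  have h := Code.evaln_sound (Option.mem_def.2 hk)
  by_cases h1 : 1 ∈ (Denumerable.ofNat Code k.unpair.2.unpair.1).eval k.unpair.2.unpair.2
  · simp only [h1, decide_true] at h
    exact absurd (Part.mem_unique h h1) (by simp)
  · simp only [h1, decide_false] at h
    exact h1 h

theorem exists_row_eq_of_computable {A : CantorSpace} (hA : A ∈ avoidanceClass RefutesRows)
    {X : CantorSpace} (hX : Computable X) : ∃ i, ∀ n, A (Nat.pair i n) = X n := by
  have hX' : Computable fun n => (X n).toNat := (Primrec.dom_bool Bool.toNat).to_comp.comp hX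
  obtain ⟨c, hc⟩ := Code.exists_code.1 (Partrec.nat_iff.1 hX'.partrec)
  refine ⟨encode c, fun n => ?_⟩
  by_contra hne
  have hmem : (X n).toNat ∈ c.eval n := by simp [hc]
  obtain ⟨s, hs⟩ := Code.evaln_complete.1 hmem
  let j := Nat.pair (encode c) n
  -- Raising the stage to at least `j + 1` makes the string coding stage and position longer than
  -- `j`, so it contains the bit to be refuted.
  have hs' := Code.evaln_mono (le_max_left s (j + 1)) hs
  have hlt : j < Nat.pair (max s (j + 1)) j :=
    (Nat.lt_of_lt_of_le (Nat.lt_succ_self j) (le_max_right _ _)).trans_le (Nat.left_le_pair _ _)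
  refine hA (Nat.pair (max s (j + 1)) j) ⟨?_, ?_⟩
  · simpa using hlt
  · have hXA : X n = !A j := by
      revert hne
      change ¬ A j = X n → _
      cases A j <;> cases X n <;> simp
    rw [length_initialSegment, Nat.unpair_pair, initialSegment_getD _ hlt, ← hXA]
    simpa [j] using hs'

/-! ### Kurtz tests computed from the rows of an oracle -/

theorem recursiveIn_initialSegment (A : CantorSpace) :
    Nat.RecursiveIn {A.oracle} fun k => Part.some (encode (initialSegment A k)) := by
  let snoc (p : ℕ) : ℕ :=
    encode ((decode (α := List Bool) p.unpair.2).getD [] ++ [decide (p.unpair.1 = 1)])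
  have hsnoc : Primrec snoc := by
    have hd : Primrec fun p : ℕ => decide (p.unpair.1 = 1) :=
      Primrec.eq.decide.comp (Primrec.fst.comp Primrec.unpair) (Primrec.const 1)
    exact Primrec.encode.comp (Primrec.list_concat.comp
      (Primrec.option_getD.comp (Primrec.decode.comp (Primrec.snd.comp Primrec.unpair))
        (Primrec.const [])) hd)
  have hsnoc' := (Primrec.nat_iff.1 hsnoc).recursiveIn (O := {A.oracle})
  have hyi : Nat.RecursiveIn {A.oracle} fun p => Part.some p.unpair.2 := .right
  have hi₁ : Nat.RecursiveIn {A.oracle} fun p => Part.some p.unpair.2.unpair.1 :=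
    (Nat.RecursiveIn.comp .left hyi).of_eq fun p => Part.bind_some _ _
  have hy : Nat.RecursiveIn {A.oracle} fun p =>
      Part.some (A p.unpair.2.unpair.1).toNat :=
    (Nat.RecursiveIn.comp (.oracle _ (Set.mem_singleton A.oracle)) hi₁).of_eq
      fun p => Part.bind_some _ _
  have hi₂ : Nat.RecursiveIn {A.oracle} fun p => Part.some p.unpair.2.unpair.2 :=
    (Nat.RecursiveIn.comp .right hyi).of_eq fun p => Part.bind_some _ _
  have hstep : Nat.RecursiveIn {A.oracle} fun p =>
      Part.some (snoc (Nat.pair (A p.unpair.2.unpair.1).toNat p.unpair.2.unpair.2)) :=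
    (Nat.RecursiveIn.comp hsnoc' (.pair hy hi₂)).of_eq fun p => by simp [Seq.seq]
  have hzero : Nat.RecursiveIn {A.oracle} fun _ => Part.some (encode ([] : List Bool)) :=
    (Primrec.nat_iff.1 (Primrec.const _)).recursiveIn
  -- The recursion scheme expects a parameter; 0 is a dummy.
  have hpair : Nat.RecursiveIn {A.oracle} fun n => Part.some (Nat.pair 0 n) :=
    (Primrec.nat_iff.1 (Primrec₂.natPair.comp (Primrec.const 0) Primrec.id)).recursiveIn
  refine (Nat.RecursiveIn.comp (.prec hzero hstep) hpair).of_eq fun k => ?_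
  simp only [Part.bind_eq_bind, Part.bind_some, Nat.unpair_pair]
  induction k with
  | zero => simp [initialSegment]
  | succ k ih =>
    refine (congrArg (Part.bind · _) ih).trans ?_
    cases h : A k <;> simp [snoc, initialSegment_succ, h]

/-- Anything obtained primitive recursively from initial segments of `A` of computable length is
computable from `A`. -/
theorem computableIn_of_initialSegment {A : CantorSpace} {α β : Type*} [Primcodable α]
    [Primcodable β] {ℓ : α → ℕ} (hℓ : Primrec ℓ) {F : α → List Bool → β} (hF : Primrec₂ F) :
    ComputableIn {A.oracle} fun a => F a (initialSegment A (ℓ a)) := by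
  have h₁ : RecursiveIn {A.oracle} fun a : α => Part.some (ℓ a) := hℓ.computableIn
  have h₂ := Nat.RecursiveIn.comp (recursiveIn_initialSegment A) h₁
  have hid : RecursiveIn {A.oracle} fun a : α => Part.some a := .some
  have h₃ : RecursiveIn {A.oracle} fun p : α × List Bool => Part.some (F p.1 p.2) :=
    (show Primrec fun p : α × List Bool => F p.1 p.2 from hF).computableIn
  refine (Nat.RecursiveIn.comp h₃ (.pair hid h₂)).of_eq fun n => ?_
  cases decode (α := α) n with
  | none => simp [Seq.seq]
  | some a => simp [Seq.seq]

theorem coinMeasure_basicClopen (σ : List Bool) :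
    coinMeasure (basicClopen σ) = (2⁻¹ : ℝ≥0∞) ^ σ.length := by
  have h : basicClopen σ =
      Set.pi (Finset.range σ.length : Set ℕ) fun n => {σ.getD n false} := by
    ext X
    simp only [basicClopen, Set.mem_ofPred_eq, Set.mem_pi, Finset.coe_range, Set.mem_Iio,
      Set.mem_singleton_iff]
    exact forall₂_congr fun n hn => by simp [hn]
  rw [h, coinMeasure, Measure.infinitePi_pi _ fun _ _ => MeasurableSet.of_discrete]
  simp

theorem clopenOf_singleton (σ : List Bool) : clopenOf [σ] = basicClopen σ := by
  ext X
  simp [clopenOf]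

/-- An oracle whose rows include all computable reals is weakly Kurtz engulfing. -/
theorem isWeaklyKurtzEngulfing_of_rows {A : CantorSpace}
    (hA : ∀ X : CantorSpace, Computable X → ∃ i, ∀ n, A (Nat.pair i n) = X n) :
    IsWeaklyKurtzEngulfing A := by
  let σ (i m : ℕ) : List Bool := initialSegment (fun n => A (Nat.pair i n)) m
  refine ⟨fun i m => clopenOf [σ i m], ⟨⟨fun i m => [σ i m], ?_, fun _ _ => rfl⟩, ?_⟩, ?_⟩
  · let F (p : ℕ × ℕ) (τ : List Bool) : List (List Bool) :=
      [(List.range p.2).map fun n => τ.getD (Nat.pair p.1 n) false]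
    have hF : Primrec₂ F := by
      refine Primrec.list_cons.comp (Primrec.list_map
        (Primrec.list_range.comp (Primrec.snd.comp Primrec.fst)) ?_) (Primrec.const [])
      exact (Primrec.list_getD false).comp (Primrec.snd.comp Primrec.fst)
        (Primrec₂.natPair.comp (Primrec.fst.comp (Primrec.fst.comp Primrec.fst)) Primrec.snd)
    -- Pairing is strictly increasing in its second argument, so this length covers the first `m`
    -- bits of row `i`.
    have hℓ : Primrec fun p : ℕ × ℕ => Nat.pair p.1 p.2 := Primrec₂.natPair
    refine (computableIn_of_initialSegment (A := A) hℓ hF).of_eq fun p => ?_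
    simp only [F, σ, initialSegment, Part.some_inj, List.cons.injEq, and_true]
    refine List.map_congr_left fun n hn => ?_
    have := initialSegment_getD A (Nat.pair_lt_pair_right p.1 (List.mem_range.1 hn))
    simpa [initialSegment] using this
  · intro i m
    simp [clopenOf_singleton, coinMeasure_basicClopen, σ]
  · intro X hX
    obtain ⟨i, hi⟩ := hA X hX
    refine Set.mem_iUnion.2 ⟨i, Set.mem_iInter.2 fun m => ?_⟩
    change X ∈ clopenOf [σ i m]
    rw [clopenOf_singleton]
    intro n hn
    simp [σ, initialSegment, hi]

/-! ### Degree invariance and conclusion -/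

theorem turingReducible_of_degree_eq {A B : CantorSpace} (h : A.degree = B.degree) :
    TuringReducible A.oracle B.oracle :=
  (Quotient.exact h).1

theorem IsHyperimmuneFreeOracle.of_turingReducible {A B : CantorSpace}
    (hB : IsHyperimmuneFreeOracle B) (h : TuringReducible A.oracle B.oracle) :
    IsHyperimmuneFreeOracle A := by
  rintro ⟨f, hf, hdom⟩
  exact hB ⟨f, RecursiveIn.subst hf (by simpa using h), hdom⟩

theorem IsWeaklyKurtzEngulfing.of_turingReducible {A B : CantorSpace}
    (hA : IsWeaklyKurtzEngulfing A) (h : TuringReducible A.oracle B.oracle) :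
    IsWeaklyKurtzEngulfing B := by
  obtain ⟨G, ⟨⟨D, hD, hG⟩, hle⟩, hcov⟩ := hA
  exact ⟨G, ⟨⟨D, RecursiveIn.subst hD (by simpa using h), hG⟩, hle⟩, hcov⟩

theorem mainTheorem7 :
    ∃ a : TuringDegree, (∃ A : CantorSpace, A.degree = a) ∧
      ∀ A : CantorSpace, A.degree = a →
        IsHyperimmuneFreeOracle A ∧ IsWeaklyKurtzEngulfing A := by
  obtain ⟨A, hA, hfree⟩ := exists_isHyperimmuneFreeOracle_mem_avoidanceClass
    primrecPred_refutesRows avoidanceClass_refutesRows_nonempty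
  have hK := isWeaklyKurtzEngulfing_of_rows fun X hX => exists_row_eq_of_computable hA hX
  exact ⟨A.degree, ⟨A, rfl⟩, fun B hB =>
    ⟨hfree.of_turingReducible (turingReducible_of_degree_eq hB),
      hK.of_turingReducible (turingReducible_of_degree_eq hB.symm)⟩⟩
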